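/- Let $n\ge 0$ and $k\ge 1$ be integers, let $a,b\in\mathbb{C}$ with $\operatorname{Re} a>0$ and $\operatorname{Re} b>0$, and let $y\in\mathbb{C}$. Write $\Delta(x)=\det(x_i^{j-1})_{1\le i,j\le n}=\prod_{1\le i<j\le n}(x_j-x_i)$, and put $$S_n(a,b;k)=\int_{[0,1]^n}|\Delta(x)|^{2k}\prod_{i=1}^n x_i^{a-1}(1-x_i)^{b-1}\,dx,$$ $$A_n^{a,b;k}(y)=\int_{[0,1]^n}\Delta(x)^{2k}\prod_{i=1}^n (y-x_i)\,x_i^{a-1}(1-x_i)^{b-1}\,dx .$$ For $\alpha,\beta\in\mathbb{C}$ with $\operatorname{Re}\alpha,\operatorname{Re}\beta>-1$, let $P_n^{\alpha,\beta}$ be the monic Jacobi polynomial of degree $n$, that is, the Jacobi polynomial $$\frac{(\alpha+1)_n}{n!}\;{}_2F_1\!\left(-n,\;n+\alpha+\beta+1;\;\alpha+1;\;\tfrac{1-X}{2}\right)$$ divided by its leading coefficient, where $(z)_m=z(z+1)\cdots(z+m-1)$. Then both integrals converge absolutely, and $$A_n^{a,b;k}(y)=(-2)^{-n}\,S_n(a,b;k)\,P_n^{\frac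 ak-1,\,\frac bk-1}(1-2y).$$ -/

import Mathlib

open MeasureTheory Polynomial

noncomputable section

/-- The Vandermonde determinant `Δ(x) = det (x_i ^ (j-1)) = ∏_{i<j} (x_j - x_i)`. -/
def vandermondeDelta {n : ℕ} (x : Fin n → ℝ) : ℝ :=
  (Matrix.vandermonde x).det

/-- The integrand `|Δ(x)|^{2k} ∏ x_i^{a-1} (1-x_i)^{b-1}` of Selberg's integral. -/
def selbergIntegrand (n : ℕ) (a b : ℂ) (k : ℕ) (x : Fin n → ℝ) : ℂ :=
  ((|vandermondeDelta x| : ℝ) : ℂ) ^ (2 * k) *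
    ∏ i, ((x i : ℂ) ^ (a - 1) * (1 - (x i : ℂ)) ^ (b - 1))

/-- Selberg's integral `S_n(a,b;k)` over the cube `[0,1]^n`. -/
def selbergIntegral (n : ℕ) (a b : ℂ) (k : ℕ) : ℂ :=
  ∫ x in Set.Icc (0 : Fin n → ℝ) 1, selbergIntegrand n a b k x

/-- The integrand `Δ(x)^{2k} ∏ (y-x_i) x_i^{a-1} (1-x_i)^{b-1}` of Aomoto's integral. -/
def aomotoIntegrand (n : ℕ) (a b : ℂ) (k : ℕ) (y : ℂ) (x : Fin n → ℝ) : ℂ :=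
  (vandermondeDelta x : ℂ) ^ (2 * k) *
    ∏ i, ((y - (x i : ℂ)) * (x i : ℂ) ^ (a - 1) * (1 - (x i : ℂ)) ^ (b - 1))

/-- Aomoto's integral `A_n^{a,b;k}(y)` over the cube `[0,1]^n`. -/
def aomotoIntegral (n : ℕ) (a b : ℂ) (k : ℕ) (y : ℂ) : ℂ :=
  ∫ x in Set.Icc (0 : Fin n → ℝ) 1, aomotoIntegrand n a b k y x

/-- The Pochhammer symbol `(z)_m = z (z+1) ⋯ (z+m-1)`. -/
def pochhammerSymbol (z : ℂ) (m : ℕ) : ℂ :=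
  (ascPochhammer ℂ m).eval z

/-- The classical Jacobi polynomial of degree `n` with parameters `α, β`,
`(α+1)_n / n! * ₂F₁(-n, n+α+β+1; α+1; (1-X)/2)`, as a polynomial in `X`. The quotient
`(α+1)_n / (α+1)_j` is written as `(α+j+1)_{n-j}`, so that no parameter is exceptional. -/
def jacobiPolynomial (n : ℕ) (α β : ℂ) : ℂ[X] :=
  C ((n.factorial : ℂ)⁻¹) *
    ∑ j ∈ Finset.range (n + 1),
      C (pochhammerSymbol (-(n : ℂ)) j * pochhammerSymbol (n + α + β + 1) j *
          pochhammerSymbol (α + j + 1) (n - j) / (j.factorial : ℂ)) *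
        (C (1 / 2 : ℂ) * (1 - X)) ^ j

/-- The monic Jacobi polynomial: the Jacobi polynomial divided by its leading coefficient. -/
def monicJacobi (n : ℕ) (α β : ℂ) : ℂ[X] :=
  C (jacobiPolynomial n α β).leadingCoeff⁻¹ * jacobiPolynomial n α β

end

/-! Expanding `∏ (y - x_i)` over subsets reduces the claim to the integrals of `∏_{i ∈ s} x_i`
against the Selberg weight. For `i ∉ s`, integrate over the cube the `x_i`-derivative of `x_i (1 -
x_i) ∏_{m ∈ s} x_m · Δ^{2k}` times the weight; since `Re a, Re b > 0`, nothing survives at the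
boundary. Differentiating `Δ^{2k}` produces terms with denominators `x_i - x_l`, which cancel after
symmetrizing under `i ↔ l` and leave only the moments of `s` and `insert i s`
(`two_mul_integral_interaction_of_notMem`, `two_mul_integral_interaction_of_mem`).

The resulting two-term recurrence `selbergMoment_insert` makes every moment an explicit product
times `S_n` (`selbergMoment_eq`); the value of `S_n` is never needed. Up to binomials and signs,
these products are the Jacobi coefficients in powers of `y = (1 - X) / 2`, divided by the top one
(`jacobiCoeff_div_self`). -/

/-! ### Integrability and integration by parts on the cube -/

/-- The one-variable weight `t^(a-1) (1-t)^(b-1)`. -/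
noncomputable def betaWeight (a b : ℂ) (t : ℝ) : ℂ :=
  (t : ℂ) ^ (a - 1) * (1 - (t : ℂ)) ^ (b - 1)

theorem integrableOn_betaWeight {a b : ℂ} (ha : 0 < a.re) (hb : 0 < b.re) :
    IntegrableOn (betaWeight a b) (Set.Icc 0 1) := by
  rw [integrableOn_Icc_iff_integrableOn_Ioc]
  exact (intervalIntegrable_iff_integrableOn_Ioc_of_le zero_le_one).1
    (Complex.betaIntegral_convergent ha hb)

theorem volume_restrict_cube (n : ℕ) :
    (volume : Measure (Fin n → ℝ)).restrict (Set.Icc 0 1) =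
      Measure.pi fun _ => volume.restrict (Set.Icc (0 : ℝ) 1) := by
  rw [volume_pi, ← Measure.restrict_pi_pi, Set.pi_univ_Icc]
  rfl

theorem integrableOn_prod_betaWeight {a b : ℂ} (ha : 0 < a.re) (hb : 0 < b.re) (n : ℕ) :
    IntegrableOn (fun x : Fin n → ℝ => ∏ i, betaWeight a b (x i)) (Set.Icc 0 1) := by
  rw [IntegrableOn, volume_restrict_cube]
  exact Integrable.fintype_prod fun _ => integrableOn_betaWeight ha hb

theorem integrableOn_mul_prod_betaWeight {a b : ℂ} (ha : 0 < a.re) (hb : 0 < b.re) {n : ℕ}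
    {g : (Fin n → ℝ) → ℂ} (hg : Continuous g) :
    IntegrableOn (fun x => g x * ∏ i, betaWeight a b (x i)) (Set.Icc 0 1) :=
  IntegrableOn.continuousOn_mul hg.continuousOn (integrableOn_prod_betaWeight ha hb n)
    isCompact_Icc

/-- The extra factor `t (1 - t)` raises both exponents of the weight by one, so the primitive
extends continuously by zero to both endpoints. -/
theorem hasDerivAt_cpow_mul_one_sub_cpow {a b : ℂ} {p : ℝ → ℂ} {p' : ℂ}
    {t : ℝ} (ht : t ∈ Set.Ioo (0 : ℝ) 1) (hp : HasDerivAt p p' t) :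
    HasDerivAt (fun t : ℝ => (t : ℂ) ^ a * (1 - (t : ℂ)) ^ b * p t)
      (betaWeight a b t * ((a - (a + b) * t) * p t + t * (1 - t) * p')) t := by
  have h0 : (t : ℂ) ≠ 0 := by exact_mod_cast ht.1.ne'
  have h1 : (1 - (t : ℂ)) ≠ 0 := by
    rw [sub_ne_zero]; exact_mod_cast ht.2.ne'
  have hA : HasDerivAt (fun t : ℝ => (t : ℂ) ^ a) (a * (t : ℂ) ^ (a - 1)) t := by
    have := (((hasDerivAt_id (t : ℂ)).cpow_const (c := a)
      (Or.inl (by simpa using ht.1)))).comp_ofReal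
    simpa using this
  have hB : HasDerivAt (fun t : ℝ => (1 - (t : ℂ)) ^ b) (-(b * (1 - (t : ℂ)) ^ (b - 1))) t := by
    have := ((((hasDerivAt_id (t : ℂ)).const_sub 1).cpow_const (c := b)
      (Or.inl (by simpa using ht.2)))).comp_ofReal
    simpa using this
  refine ((hA.mul hB).mul hp).congr_deriv ?_
  have ea : (t : ℂ) ^ a = (t : ℂ) ^ (a - 1) * t := by
    rw [Complex.cpow_sub _ _ h0, Complex.cpow_one, div_mul_cancel₀ _ h0]
  have eb : (1 - (t : ℂ)) ^ b = (1 - (t : ℂ)) ^ (b - 1) * (1 - t) := by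
    rw [Complex.cpow_sub _ _ h1, Complex.cpow_one, div_mul_cancel₀ _ h1]
  simp only [Pi.mul_apply, betaWeight]
  rw [ea, eb]
  ring

/-- Integration by parts against the beta weight; the boundary terms vanish. -/
theorem integral_betaWeight_mul_deriv_eq_zero {a b : ℂ} (ha : 0 < a.re) (hb : 0 < b.re)
    {p p' : ℝ → ℂ} (hp : ∀ t, HasDerivAt p (p' t) t) (hp' : Continuous p') :
    ∫ t in Set.Icc (0 : ℝ) 1,
      betaWeight a b t * ((a - (a + b) * t) * p t + t * (1 - t) * p' t) = 0 := by
  have hpc : Continuous p := continuous_iff_continuousAt.2 fun t => (hp t).continuousAt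
  have ha0 : a ≠ 0 := by rintro rfl; simp at ha
  have hb0 : b ≠ 0 := by rintro rfl; simp at hb
  have hcont : Continuous fun t : ℝ => (t : ℂ) ^ a * (1 - (t : ℂ)) ^ b * p t := by
    refine ((Complex.continuous_ofReal_cpow_const ha).mul ?_).mul hpc
    have := (Complex.continuous_ofReal_cpow_const hb).comp (continuous_const.sub continuous_id :
      Continuous fun t : ℝ => 1 - t)
    simpa [Function.comp_def] using this
  have hint : IntervalIntegrable (fun t : ℝ =>
      betaWeight a b t * ((a - (a + b) * t) * p t + t * (1 - t) * p' t)) volume 0 1 := by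
    rw [intervalIntegrable_iff_integrableOn_Icc_of_le zero_le_one]
    refine IntegrableOn.mul_continuousOn (integrableOn_betaWeight ha hb) ?_ isCompact_Icc
    fun_prop
  have := intervalIntegral.integral_eq_sub_of_hasDerivAt_of_le zero_le_one hcont.continuousOn
    (fun t ht => hasDerivAt_cpow_mul_one_sub_cpow ht (hp t)) hint
  rw [integral_Icc_eq_integral_Ioc, ← intervalIntegral.integral_of_le zero_le_one, this]
  simp [ha0, hb0]

/-- Integration by parts in the `i`-th variable over the cube. -/
theorem integral_cube_deriv_eq_zero {a b : ℂ} (ha : 0 < a.re) (hb : 0 < b.re) {n : ℕ}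
    (i : Fin (n + 1)) {p p' : (Fin (n + 1) → ℝ) → ℂ}
    (hp : ∀ t z, HasDerivAt (fun t => p (i.insertNth t z)) (p' (i.insertNth t z)) t)
    (hpc : Continuous p) (hp' : Continuous p') :
    ∫ x in Set.Icc (0 : Fin (n + 1) → ℝ) 1,
      ((a - (a + b) * x i) * p x + x i * (1 - x i) * p' x) * ∏ j, betaWeight a b (x j) = 0 := by
  have hint := integrableOn_mul_prod_betaWeight ha hb (n := n + 1)
    (g := fun x => (a - (a + b) * x i) * p x + x i * (1 - x i) * p' x) (by fun_prop)
  rw [IntegrableOn, volume_restrict_cube] at hint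
  rw [volume_restrict_cube]
  have hmp := (measurePreserving_piFinSuccAbove
    (fun _ : Fin (n + 1) => volume.restrict (Set.Icc (0 : ℝ) 1)) i).symm
  rw [← hmp.integral_comp']
  replace hint := (hmp.integrable_comp_emb (MeasurableEquiv.measurableEmbedding _)).2 hint
  -- Fubini with the `i`-th variable innermost: each inner integral is the one-variable one times a
  -- constant.
  refine (integral_prod_symm _ hint).trans ?_
  refine integral_eq_zero_of_ae (Filter.Eventually.of_forall fun z => ?_)
  have hc : Continuous fun t : ℝ => p' (i.insertNth t z) :=
    hp'.comp (Continuous.finInsertNth (A := fun _ => ℝ) i continuous_id continuous_const)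
  have := integral_betaWeight_mul_deriv_eq_zero ha hb (fun t => hp t z) hc
  have h2 := congrArg (· * ∏ j, betaWeight a b (z j)) this
  simp only [zero_mul] at h2
  rw [← integral_mul_const] at h2
  refine (integral_congr_ae (Filter.Eventually.of_forall fun t => ?_)).trans h2
  have he : Fin.insertNthEquiv (fun _ => ℝ) i (t, z) = i.insertNth t z := rfl
  simp only [Function.comp_apply, MeasurableEquiv.piFinSuccAbove_symm_apply, he,
    Fin.insertNth_apply_same, Fin.prod_univ_succAbove _ i, Fin.insertNth_apply_succAbove]
  ring

theorem integral_cube_comp_perm {n : ℕ} (σ : Equiv.Perm (Fin n)) (f : (Fin n → ℝ) → ℂ) :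
    ∫ x in Set.Icc (0 : Fin n → ℝ) 1, f (x ∘ σ) = ∫ x in Set.Icc (0 : Fin n → ℝ) 1, f x := by
  rw [volume_restrict_cube]
  have h := measurePreserving_piCongrLeft
    (fun _ : Fin n => volume.restrict (Set.Icc (0 : ℝ) 1)) σ
  rw [← h.integral_comp']
  refine integral_congr_ae (Filter.Eventually.of_forall fun x => congrArg f ?_)
  ext j
  exact MeasurableEquiv.piCongrLeft_apply_apply (β := fun _ : Fin n => ℝ) (e := σ) x j

/-! ### The Vandermonde determinant -/

theorem vandermondeDelta_comp_perm_sq {n : ℕ} (σ : Equiv.Perm (Fin n)) (x : Fin n → ℝ) :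
    vandermondeDelta (x ∘ σ) ^ 2 = vandermondeDelta x ^ 2 := by
  have h : Matrix.vandermonde (x ∘ σ) = (Matrix.vandermonde x).submatrix σ id := rfl
  rw [vandermondeDelta, h, Matrix.det_permute, mul_pow, vandermondeDelta]
  rcases Int.units_eq_one_or (Equiv.Perm.sign σ) with h | h <;> simp [h]

theorem vandermondeDelta_sq_eq_prod_mul {n : ℕ} (i : Fin (n + 1)) (x : Fin (n + 1) → ℝ) :
    vandermondeDelta x ^ 2 =
      (∏ j, (x (i.succAbove j) - x i) ^ 2) * vandermondeDelta (x ∘ i.succAbove) ^ 2 := by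
  -- This cycle moves index `i` to the front and keeps the others in order; squaring removes its
  -- sign.
  rw [← vandermondeDelta_comp_perm_sq i.cycleRange.symm x]
  simp only [vandermondeDelta, Matrix.det_vandermonde]
  rw [Fin.prod_univ_succ]
  simp [Fin.prod_Ioi_succ, mul_pow, Finset.prod_pow]

theorem continuous_vandermondeDelta {n : ℕ} : Continuous (vandermondeDelta (n := n)) := by
  unfold vandermondeDelta
  simp only [Matrix.det_vandermonde]
  fun_prop

/-- The factor `Δ(x)^{2k}` as a complex number. -/
noncomputable def deltaPow (n k : ℕ) (x : Fin n → ℝ) : ℂ := (vandermondeDelta x : ℂ) ^ (2 * k)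

theorem continuous_deltaPow (n k : ℕ) : Continuous (deltaPow n k) := by
  have := continuous_vandermondeDelta (n := n)
  unfold deltaPow
  fun_prop

theorem deltaPow_comp_perm {n : ℕ} (k : ℕ) (σ : Equiv.Perm (Fin n)) (x : Fin n → ℝ) :
    deltaPow n k (x ∘ σ) = deltaPow n k x := by
  simp only [deltaPow, pow_mul]
  exact_mod_cast congrArg (fun r : ℝ => (r : ℂ) ^ k) (vandermondeDelta_comp_perm_sq σ x)

theorem deltaPow_eq_prod_mul {n : ℕ} (k : ℕ) (i : Fin (n + 1)) (x : Fin (n + 1) → ℝ) :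
    deltaPow (n + 1) k x =
      (∏ j, ((x (i.succAbove j) : ℂ) - x i) ^ (2 * k)) * deltaPow n k (x ∘ i.succAbove) := by
  have := congrArg (fun r : ℝ => (r : ℂ) ^ k) (vandermondeDelta_sq_eq_prod_mul i x)
  simpa [deltaPow, pow_mul, mul_pow, Finset.prod_pow] using this

/-- As `2k ≥ 2`, the quotient is a polynomial even on the diagonal, where division by zero returns
`0`, the correct value. -/
theorem pow_div_sub_eq {k : ℕ} (hk : 1 ≤ k) (u v : ℂ) :
    (v - u) ^ (2 * k) / (u - v) = -(v - u) ^ (2 * k - 1) := by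
  rcases eq_or_ne u v with rfl | h
  · simp [show 2 * k - 1 ≠ 0 by omega]
  · have h1 : u - v ≠ 0 := sub_ne_zero.2 h
    rw [div_eq_iff h1, show 2 * k = 2 * k - 1 + 1 by omega, pow_succ]
    simp only [add_tsub_cancel_right]
    ring

theorem continuous_deltaPow_div {n k : ℕ} (hk : 1 ≤ k) (i : Fin (n + 1)) (j : Fin n) :
    Continuous fun x : Fin (n + 1) → ℝ =>
      deltaPow (n + 1) k x / ((x i : ℂ) - x (i.succAbove j)) := by
  have h : (fun x : Fin (n + 1) → ℝ =>
      deltaPow (n + 1) k x / ((x i : ℂ) - x (i.succAbove j))) = fun x =>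
        -((x (i.succAbove j) : ℂ) - x i) ^ (2 * k - 1) *
        (∏ l ∈ Finset.univ.erase j, ((x (i.succAbove l) : ℂ) - x i) ^ (2 * k)) *
          deltaPow n k (x ∘ i.succAbove) := by
    ext x
    rw [deltaPow_eq_prod_mul k i, ← Finset.mul_prod_erase _ _ (Finset.mem_univ j),
      ← pow_div_sub_eq hk]
    ring
  rw [h]
  have := continuous_deltaPow n k
  fun_prop

theorem hasDerivAt_deltaPow {n k : ℕ} (hk : 1 ≤ k) (i : Fin (n + 1)) (t : ℝ) (z : Fin n → ℝ) :
    HasDerivAt (fun t : ℝ => deltaPow (n + 1) k (i.insertNth t z))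
      (∑ j, 2 * k * (deltaPow (n + 1) k (i.insertNth t z) / ((t : ℂ) - z j))) t := by
  have hid : HasDerivAt (fun t : ℝ => (t : ℂ)) 1 t := (hasDerivAt_id t).ofReal_comp
  have e (t : ℝ) : deltaPow (n + 1) k (i.insertNth t z) =
      (∏ j, ((z j : ℂ) - t) ^ (2 * k)) * deltaPow n k z := by
    rw [deltaPow_eq_prod_mul k i]
    simp [Function.comp_def]
  simp only [e]
  have h := (HasDerivAt.fun_finsetProd (u := Finset.univ)
    (fun j _ => ((hid.const_sub (z j : ℂ)).pow (2 * k)))).mul_const (deltaPow n k z)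
  refine h.congr_deriv ?_
  rw [Finset.sum_mul]
  refine Finset.sum_congr rfl fun j _ => ?_
  rw [← Finset.mul_prod_erase _ _ (Finset.mem_univ j)]
  have := pow_div_sub_eq hk (t : ℂ) (z j)
  rw [mul_assoc ((z j - t : ℂ) ^ (2 * k)), mul_div_right_comm, this]
  simp only [Pi.pow_apply, smul_eq_mul]
  push_cast
  ring

/-! ### Moments of the Selberg weight and their recurrence -/

/-- The integral of `g` over the cube against the product beta weight. -/
noncomputable def betaCubeIntegral (n : ℕ) (a b : ℂ) (g : (Fin n → ℝ) → ℂ) : ℂ :=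
  ∫ x in Set.Icc (0 : Fin n → ℝ) 1, g x * ∏ j, betaWeight a b (x j)

section
variable {a b : ℂ} {n : ℕ}

theorem betaCubeIntegral_add (ha : 0 < a.re) (hb : 0 < b.re) {f g : (Fin n → ℝ) → ℂ}
    (hf : Continuous f) (hg : Continuous g) :
    betaCubeIntegral n a b (fun x => f x + g x) =
      betaCubeIntegral n a b f + betaCubeIntegral n a b g := by
  simp only [betaCubeIntegral, add_mul]
  exact integral_add (integrableOn_mul_prod_betaWeight ha hb hf)
    (integrableOn_mul_prod_betaWeight ha hb hg)

theorem betaCubeIntegral_const_mul (c : ℂ) (f : (Fin n → ℝ) → ℂ) :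
    betaCubeIntegral n a b (fun x => c * f x) = c * betaCubeIntegral n a b f := by
  simp only [betaCubeIntegral, mul_assoc]
  exact integral_const_mul _ _

theorem betaCubeIntegral_sum (ha : 0 < a.re) (hb : 0 < b.re) {ι : Type*} (s : Finset ι)
    {f : ι → (Fin n → ℝ) → ℂ} (hf : ∀ i, Continuous (f i)) :
    betaCubeIntegral n a b (fun x => ∑ i ∈ s, f i x) = ∑ i ∈ s, betaCubeIntegral n a b (f i) := by
  simp only [betaCubeIntegral, Finset.sum_mul]
  exact integral_finsetSum _ fun i _ => integrableOn_mul_prod_betaWeight ha hb (hf i)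

theorem betaCubeIntegral_comp_perm (σ : Equiv.Perm (Fin n)) (f : (Fin n → ℝ) → ℂ) :
    betaCubeIntegral n a b (fun x => f (x ∘ σ)) = betaCubeIntegral n a b f := by
  refine Eq.trans ?_ (integral_cube_comp_perm σ fun x => f x * ∏ j, betaWeight a b (x j))
  refine integral_congr_ae (Filter.Eventually.of_forall fun x => ?_)
  exact congrArg (f (x ∘ σ) * ·) (Equiv.prod_comp σ fun j => betaWeight a b (x j)).symm

end

/-- The integral of `∏_{i ∈ s} x_i` against the Selberg weight. -/
noncomputable def selbergMoment (n : ℕ) (a b : ℂ) (k : ℕ) (s : Finset (Fin n)) : ℂ :=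
  betaCubeIntegral n a b fun x => (∏ i ∈ s, (x i : ℂ)) * deltaPow n k x

theorem deltaPow_eq_zero {n k : ℕ} (hk : 1 ≤ k) {i l : Fin n} (hil : i ≠ l) {x : Fin n → ℝ}
    (h : x i = x l) : deltaPow n k x = 0 := by
  have : vandermondeDelta x = 0 := Matrix.det_vandermonde_eq_zero_iff.2 ⟨i, l, h, hil⟩
  simp [deltaPow, this, show k ≠ 0 by omega]

theorem prod_comp_swap_of_notMem {n : ℕ} {i l : Fin n} {s : Finset (Fin n)} (hi : i ∉ s)
    (hl : l ∉ s) (x : Fin n → ℝ) :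
    ∏ m ∈ s, (((x ∘ Equiv.swap i l) m : ℝ) : ℂ) = ∏ m ∈ s, (x m : ℂ) := by
  refine Finset.prod_congr rfl fun m hm => ?_
  rw [Function.comp_apply, Equiv.swap_apply_of_ne_of_ne] <;> rintro rfl <;> contradiction

theorem selbergMoment_insert_comm {n : ℕ} (a b : ℂ) (k : ℕ) {i l : Fin n} {s : Finset (Fin n)}
    (hi : i ∉ s) (hl : l ∉ s) :
    selbergMoment n a b k (insert l s) = selbergMoment n a b k (insert i s) := by
  rw [selbergMoment, ← betaCubeIntegral_comp_perm (Equiv.swap i l), selbergMoment]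
  congr 1
  ext x
  rw [Finset.prod_insert hi, Finset.prod_insert hl, prod_comp_swap_of_notMem hi hl,
    deltaPow_comp_perm]
  simp

theorem two_mul_betaCubeIntegral_of_symm {n : ℕ} {a b : ℂ} (ha : 0 < a.re) (hb : 0 < b.re)
    (σ : Equiv.Perm (Fin n)) {f : (Fin n → ℝ) → ℂ} (hf : Continuous f) :
    2 * betaCubeIntegral n a b f = betaCubeIntegral n a b (fun x => f x + f (x ∘ σ)) := by
  have hσ : Continuous fun x : Fin n → ℝ => f (x ∘ σ) :=
    hf.comp (continuous_pi fun j => continuous_apply (σ j))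
  rw [betaCubeIntegral_add ha hb hf hσ, betaCubeIntegral_comp_perm]
  ring

/-- Adding the swapped integrand uses `x_i (1 - x_i) - x_l (1 - x_l) = (x_i - x_l) (1 - x_i - x_l)`;
the moments with `i` or `l` adjoined agree by symmetry. -/
theorem two_mul_integral_interaction_of_notMem {n : ℕ} {a b : ℂ} (ha : 0 < a.re) (hb : 0 < b.re)
    {k : ℕ} (hk : 1 ≤ k) {i l : Fin n} (hil : i ≠ l) {s : Finset (Fin n)} (hi : i ∉ s)
    (hl : l ∉ s)
    (hc : Continuous fun x : Fin n → ℝ => deltaPow n k x / ((x i : ℂ) - x l)) :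
    2 * betaCubeIntegral n a b (fun x => x i * (1 - x i) * (∏ m ∈ s, (x m : ℂ)) *
        (deltaPow n k x / ((x i : ℂ) - x l))) =
      selbergMoment n a b k s - 2 * selbergMoment n a b k (insert i s) := by
  have hd := continuous_deltaPow n k
  have e : selbergMoment n a b k s - 2 * selbergMoment n a b k (insert i s) =
      selbergMoment n a b k s + -1 * selbergMoment n a b k (insert i s) +
        -1 * selbergMoment n a b k (insert l s) := by
    rw [selbergMoment_insert_comm a b k hi hl]; ring
  rw [two_mul_betaCubeIntegral_of_symm ha hb (Equiv.swap i l) (by fun_prop), e]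
  simp only [selbergMoment]
  rw [← betaCubeIntegral_const_mul, ← betaCubeIntegral_const_mul,
    ← betaCubeIntegral_add ha hb (by fun_prop) (by fun_prop),
    ← betaCubeIntegral_add ha hb (by fun_prop) (by fun_prop)]
  congr 1
  ext x
  rw [Finset.prod_insert hi, Finset.prod_insert hl, prod_comp_swap_of_notMem hi hl,
    deltaPow_comp_perm]
  simp only [Function.comp_apply, Equiv.swap_apply_left, Equiv.swap_apply_right]
  by_cases h : x i = x l
  · simp [deltaPow_eq_zero hk hil h]
  · have h1 : (x i : ℂ) - x l ≠ 0 := sub_ne_zero.2 (by exact_mod_cast h)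
    have h2 : (x l : ℂ) - x i ≠ 0 := sub_ne_zero.2 (by exact_mod_cast Ne.symm h)
    rw [← neg_sub (x i : ℂ) (x l)]
    field_simp
    ring

/-- With `x_l` already in the product, the symmetrized numerator is `x_i x_l (x_l - x_i)`, so only
`-x_i x_l` survives. -/
theorem two_mul_integral_interaction_of_mem {n : ℕ} {a b : ℂ} (ha : 0 < a.re) (hb : 0 < b.re)
    {k : ℕ} (hk : 1 ≤ k) {i l : Fin n} (hil : i ≠ l) {s : Finset (Fin n)} (hi : i ∉ s)
    (hl : l ∈ s)
    (hc : Continuous fun x : Fin n → ℝ => deltaPow n k x / ((x i : ℂ) - x l)) :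
    2 * betaCubeIntegral n a b (fun x => x i * (1 - x i) * (∏ m ∈ s, (x m : ℂ)) *
        (deltaPow n k x / ((x i : ℂ) - x l))) =
      - selbergMoment n a b k (insert i s) := by
  rw [two_mul_betaCubeIntegral_of_symm ha hb (Equiv.swap i l) (by fun_prop), selbergMoment,
    ← neg_one_mul, ← betaCubeIntegral_const_mul]
  congr 1
  ext x
  have hi' : i ∉ s.erase l := fun h => hi (Finset.mem_of_mem_erase h)
  rw [Finset.prod_insert hi, ← Finset.mul_prod_erase s _ hl, ← Finset.mul_prod_erase s _ hl,
    prod_comp_swap_of_notMem hi' (Finset.notMem_erase l s), deltaPow_comp_perm]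
  simp only [Function.comp_apply, Equiv.swap_apply_left, Equiv.swap_apply_right]
  by_cases h : x i = x l
  · simp [deltaPow_eq_zero hk hil h]
  · have h1 : (x i : ℂ) - x l ≠ 0 := sub_ne_zero.2 (by exact_mod_cast h)
    have h2 : (x l : ℂ) - x i ≠ 0 := sub_ne_zero.2 (by exact_mod_cast Ne.symm h)
    rw [← neg_sub (x i : ℂ) (x l)]
    field_simp
    ring

/-- Aomoto's recurrence for the moments. -/
theorem selbergMoment_insert {n : ℕ} {a b : ℂ} (ha : 0 < a.re) (hb : 0 < b.re)
    {k : ℕ} (hk : 1 ≤ k) {i : Fin (n + 1)} {s : Finset (Fin (n + 1))} (hi : i ∉ s) :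
    (a + b + k * (2 * n - s.card)) * selbergMoment (n + 1) a b k (insert i s) =
      (a + k * (n - s.card)) * selbergMoment (n + 1) a b k s := by
  have hd := continuous_deltaPow (n + 1) k
  have hq := fun j => continuous_deltaPow_div hk i j
  set I := selbergMoment (n + 1) a b k s
  set I' := selbergMoment (n + 1) a b k (insert i s)
  have hder (t : ℝ) (z : Fin n → ℝ) : HasDerivAt
      (fun t : ℝ => (∏ m ∈ s, ((i.insertNth t z : Fin (n + 1) → ℝ) m : ℂ)) *
        deltaPow (n + 1) k (i.insertNth t z))
      ((fun x : Fin (n + 1) → ℝ => ∑ j, 2 * k * ((∏ m ∈ s, (x m : ℂ)) *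
        (deltaPow (n + 1) k x / ((x i : ℂ) - x (i.succAbove j))))) (i.insertNth t z)) t := by
    have e (u : ℝ) : ∏ m ∈ s, ((i.insertNth u z : Fin (n + 1) → ℝ) m : ℂ) =
        ∏ m ∈ s, ((i.insertNth t z : Fin (n + 1) → ℝ) m : ℂ) := by
      refine Finset.prod_congr rfl fun m hm => ?_
      obtain ⟨j, rfl⟩ := Fin.exists_succAbove_eq (show m ≠ i by rintro rfl; contradiction)
      simp
    simp only [e]
    refine ((hasDerivAt_deltaPow hk i t z).const_mul _).congr_deriv ?_
    simp only [Fin.insertNth_apply_same, Fin.insertNth_apply_succAbove, Finset.mul_sum]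
    exact Finset.sum_congr rfl fun j _ => by ring
  have h0 : betaCubeIntegral (n + 1) a b _ = 0 := integral_cube_deriv_eq_zero ha hb i
    (p := fun x => (∏ m ∈ s, (x m : ℂ)) * deltaPow (n + 1) k x)
    (p' := fun x => ∑ j, 2 * k * ((∏ m ∈ s, (x m : ℂ)) *
      (deltaPow (n + 1) k x / ((x i : ℂ) - x (i.succAbove j))))) hder (by fun_prop) (by fun_prop)
  have hsplit : (fun x : Fin (n + 1) → ℝ =>
      (a - (a + b) * x i) * ((∏ m ∈ s, (x m : ℂ)) * deltaPow (n + 1) k x) +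
        x i * (1 - x i) * ∑ j, 2 * k * ((∏ m ∈ s, (x m : ℂ)) *
          (deltaPow (n + 1) k x / ((x i : ℂ) - x (i.succAbove j))))) = fun x =>
      a * ((∏ m ∈ s, (x m : ℂ)) * deltaPow (n + 1) k x) +
        -(a + b) * ((∏ m ∈ insert i s, (x m : ℂ)) * deltaPow (n + 1) k x) +
        k * ∑ j, 2 * (x i * (1 - x i) * (∏ m ∈ s, (x m : ℂ)) *
          (deltaPow (n + 1) k x / ((x i : ℂ) - x (i.succAbove j)))) := by
    ext x
    rw [Finset.prod_insert hi, Finset.mul_sum, Finset.mul_sum]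
    congr 1
    · ring
    · exact Finset.sum_congr rfl fun j _ => by ring
  rw [hsplit, betaCubeIntegral_add ha hb (by fun_prop) (by fun_prop),
    betaCubeIntegral_add ha hb (by fun_prop) (by fun_prop), betaCubeIntegral_const_mul,
    betaCubeIntegral_const_mul, betaCubeIntegral_const_mul,
    betaCubeIntegral_sum ha hb _ (fun j => by fun_prop)] at h0
  change a * I + -(a + b) * I' + _ = 0 at h0
  -- Each index contributes `I - 2 * I'`, corrected by `I' - I` when it lies in `s`; the corrections
  -- add up to `s.card * (I' - I)`.
  have hterm (j : Fin n) : betaCubeIntegral (n + 1) a b (fun x =>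
      2 * (x i * (1 - x i) * (∏ m ∈ s, (x m : ℂ)) *
          (deltaPow (n + 1) k x / ((x i : ℂ) - x (i.succAbove j))))) =
      (I - 2 * I') + if i.succAbove j ∈ s then I' - I else 0 := by
    rw [betaCubeIntegral_const_mul]
    split_ifs with h
    · rw [two_mul_integral_interaction_of_mem ha hb hk (Fin.succAbove_ne i j).symm hi h (hq j)]
      ring
    · rw [two_mul_integral_interaction_of_notMem ha hb hk (Fin.succAbove_ne i j).symm hi h (hq j)]
      ring
  have hcount : ∑ j, (if i.succAbove j ∈ s then I' - I else 0) = s.card * (I' - I) := by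
    have := Fin.sum_univ_succAbove (fun l => if l ∈ s then I' - I else 0) i
    rw [if_neg hi, zero_add] at this
    rw [← this]
    simp [mul_sub]
  simp only [hterm, Finset.sum_add_distrib, hcount] at h0
  simp only [Finset.sum_const, Finset.card_univ, Fintype.card_fin, nsmul_eq_mul] at h0
  linear_combination -h0

/-- The ratio of the `m`-th moment to the Selberg integral. -/
noncomputable def aomotoRatio (n : ℕ) (a b : ℂ) (k m : ℕ) : ℂ :=
  ∏ i ∈ Finset.range m, (a + k * (n - 1 - i)) / (a + b + k * (2 * n - 2 - i))

theorem ne_zero_of_pos_re_add_natCast {z : ℂ} (hz : 0 < z.re) (m : ℕ) : z + m ≠ 0 := by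
  intro h
  have := congrArg Complex.re h
  simp only [Complex.add_re, Complex.natCast_re, Complex.zero_re] at this
  have : (0 : ℝ) ≤ m := Nat.cast_nonneg m
  linarith

theorem selbergMoment_eq {n : ℕ} {a b : ℂ} (ha : 0 < a.re) (hb : 0 < b.re)
    {k : ℕ} (hk : 1 ≤ k) (s : Finset (Fin n)) :
    selbergMoment n a b k s = selbergMoment n a b k ∅ * aomotoRatio n a b k s.card := by
  induction s using Finset.induction_on with
  | empty => simp [aomotoRatio]
  | insert i s hi ih =>
    obtain _ | n := n
    · exact i.elim0
    have h := selbergMoment_insert ha hb hk hi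
    have hs : s.card ≤ n := by
      have := Finset.card_le_univ (insert i s)
      rw [Finset.card_insert_of_notMem hi, Fintype.card_fin] at this
      omega
    -- Since `s.card ≤ n`, this is `a + b` plus a natural number, so its real part is positive.
    have hne : a + b + k * (2 * n - s.card) ≠ 0 := by
      have := ne_zero_of_pos_re_add_natCast (z := a + b) (by simpa using add_pos ha hb)
        (k * (2 * n - s.card))
      rwa [Nat.cast_mul, Nat.cast_sub (by omega), Nat.cast_mul, Nat.cast_two] at this
    have e1 : (2 * ((n + 1 : ℕ) : ℂ) - 2 - s.card) = 2 * n - s.card := by push_cast; ring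
    have e2 : (((n + 1 : ℕ) : ℂ) - 1 - s.card) = n - s.card := by push_cast; ring
    rw [Finset.card_insert_of_notMem hi, aomotoRatio, Finset.prod_range_succ, e1, e2, ← mul_assoc,
      ← aomotoRatio, ← ih, mul_div_assoc', eq_div_iff hne]
    linear_combination h

theorem selbergIntegrand_eq (n : ℕ) (a b : ℂ) (k : ℕ) (x : Fin n → ℝ) :
    selbergIntegrand n a b k x = deltaPow n k x * ∏ i, betaWeight a b (x i) := by
  have h : ((|vandermondeDelta x| : ℝ) : ℂ) ^ (2 * k) = deltaPow n k x := by
    rw [deltaPow, ← Complex.ofReal_pow, pow_mul, sq_abs, ← pow_mul, Complex.ofReal_pow]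
  rw [selbergIntegrand, h]
  rfl

theorem aomotoIntegrand_eq (n : ℕ) (a b : ℂ) (k : ℕ) (y : ℂ) (x : Fin n → ℝ) :
    aomotoIntegrand n a b k y x =
      ((∏ i, (y - (x i : ℂ))) * deltaPow n k x) * ∏ i, betaWeight a b (x i) := by
  simp only [aomotoIntegrand, mul_assoc (y - _), Finset.prod_mul_distrib, betaWeight, deltaPow]
  ring

theorem aomotoIntegral_eq_sum {n : ℕ} {a b : ℂ} (ha : 0 < a.re) (hb : 0 < b.re)
    {k : ℕ} (hk : 1 ≤ k) (y : ℂ) :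
    aomotoIntegral n a b k y = selbergIntegral n a b k *
      ∑ m ∈ Finset.range (n + 1), n.choose m * ((-1) ^ m * y ^ (n - m) * aomotoRatio n a b k m) := by
  have hd := continuous_deltaPow n k
  have hS : selbergIntegral n a b k = selbergMoment n a b k ∅ := by
    simp [selbergIntegral, selbergMoment, betaCubeIntegral, selbergIntegrand_eq]
  have hA : aomotoIntegral n a b k y = betaCubeIntegral n a b fun x =>
      ∑ t : Finset (Fin n), ((-1) ^ t.card * y ^ (n - t.card)) *
        ((∏ i ∈ t, (x i : ℂ)) * deltaPow n k x) := by
    simp only [aomotoIntegral, betaCubeIntegral, aomotoIntegrand_eq]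
    congr! 3 with x
    have : ∏ i, (y - (x i : ℂ)) = ∏ i, (-(x i : ℂ) + y) :=
      Finset.prod_congr rfl fun i _ => by ring
    rw [this, Fintype.prod_add, Finset.sum_mul]
    refine Finset.sum_congr rfl fun t _ => ?_
    rw [Finset.prod_neg, Finset.prod_const, Finset.card_compl, Fintype.card_fin]
    ring
  rw [hA, betaCubeIntegral_sum ha hb _ (fun t => by fun_prop), hS]
  simp only [betaCubeIntegral_const_mul]
  change ∑ t, _ * selbergMoment n a b k t = _
  have := Finset.sum_powerset_apply_card (x := (Finset.univ : Finset (Fin n)))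
    (fun m => (-1) ^ m * y ^ (n - m) * aomotoRatio n a b k m)
  simp only [Finset.powerset_univ, Finset.card_univ, Fintype.card_fin, nsmul_eq_mul] at this
  rw [← this, Finset.mul_sum]
  refine Finset.sum_congr rfl fun t _ => ?_
  rw [selbergMoment_eq ha hb hk t]
  ring

/-! ### Comparison with the Jacobi coefficients -/

theorem pochhammerSymbol_eq_prod (z : ℂ) (m : ℕ) :
    pochhammerSymbol z m = ∏ i ∈ Finset.range m, (z + i) := by
  induction m with
  | zero => simp [pochhammerSymbol]
  | succ m ih =>
    rw [Finset.prod_range_succ, ← ih, pochhammerSymbol, pochhammerSymbol, ascPochhammer_succ_eval]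

theorem pochhammerSymbol_add (z : ℂ) (j m : ℕ) :
    pochhammerSymbol z (j + m) = pochhammerSymbol z j * pochhammerSymbol (z + j) m := by
  simp only [pochhammerSymbol_eq_prod, Finset.prod_range_add, Nat.cast_add, add_assoc]

theorem pochhammerSymbol_neg_natCast_self (m : ℕ) :
    pochhammerSymbol (-(m : ℂ)) m = (-1) ^ m * m.factorial := by
  rw [pochhammerSymbol_eq_prod, ← Finset.prod_range_reflect, ← Finset.prod_range_add_one_eq_factorial,
    Nat.cast_prod, ← Finset.card_range m, ← Finset.prod_const, Finset.card_range,
    ← Finset.prod_mul_distrib]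
  refine Finset.prod_congr rfl fun i hi => ?_
  have : i + 1 ≤ m := Finset.mem_range.1 hi
  rw [show m - 1 - i = m - (i + 1) by omega, Nat.cast_sub this]
  push_cast
  ring

/-- The coefficients of the Jacobi polynomial in powers of `(1 - X) / 2`, up to `1 / n!`. -/
noncomputable def jacobiCoeff (n : ℕ) (α β : ℂ) (j : ℕ) : ℂ :=
  pochhammerSymbol (-(n : ℂ)) j * pochhammerSymbol (n + α + β + 1) j *
    pochhammerSymbol (α + j + 1) (n - j) / (j.factorial : ℂ)

theorem leadingCoeff_sum_C_mul_X_pow {n : ℕ} {d : ℕ → ℂ} (hd : d n ≠ 0) :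
    (∑ j ∈ Finset.range (n + 1), C (d j) * X ^ j : ℂ[X]).natDegree = n ∧
      (∑ j ∈ Finset.range (n + 1), C (d j) * X ^ j : ℂ[X]).leadingCoeff = d n := by
  have hc : (∑ j ∈ Finset.range (n + 1), C (d j) * X ^ j : ℂ[X]).coeff n = d n := by
    simp [coeff_X_pow]
  have hn : (∑ j ∈ Finset.range (n + 1), C (d j) * X ^ j : ℂ[X]).natDegree = n := by
    refine natDegree_eq_of_le_of_coeff_ne_zero ?_ (hc ▸ hd)
    refine natDegree_sum_le_of_forall_le _ _ fun j hj => ?_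
    exact (natDegree_C_mul_X_pow_le _ _).trans (Nat.lt_succ_iff.1 (Finset.mem_range.1 hj))
  exact ⟨hn, by rw [leadingCoeff, hn, hc]⟩

theorem leadingCoeff_jacobiPolynomial {n : ℕ} {α β : ℂ} (h : jacobiCoeff n α β n ≠ 0) :
    (jacobiPolynomial n α β).leadingCoeff =
      (n.factorial : ℂ)⁻¹ * (jacobiCoeff n α β n * (-1 / 2) ^ n) := by
  have e : jacobiPolynomial n α β = C ((n.factorial : ℂ)⁻¹) *
      (∑ j ∈ Finset.range (n + 1), C (jacobiCoeff n α β j) * X ^ j : ℂ[X]).comp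
        (C (-1 / 2) * X + C (1 / 2)) := by
    have hq : (C (-1 / 2) * X + C (1 / 2) : ℂ[X]) = C (1 / 2) * (1 - X) := by
      rw [show (-1 / 2 : ℂ) = -(1 / 2) by ring, C_neg]
      ring
    rw [hq, Polynomial.sum_comp]
    simp [jacobiPolynomial, jacobiCoeff]
  have hne : (-1 / 2 : ℂ) ≠ 0 := by norm_num
  obtain ⟨h1, h2⟩ := leadingCoeff_sum_C_mul_X_pow h
  rw [e, leadingCoeff_mul, leadingCoeff_C, leadingCoeff_comp (by
    rw [natDegree_linear hne]; exact one_ne_zero), leadingCoeff_linear hne, h1, h2]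

theorem eval_jacobiPolynomial (n : ℕ) (α β y : ℂ) :
    (jacobiPolynomial n α β).eval (1 - 2 * y) =
      (n.factorial : ℂ)⁻¹ * ∑ j ∈ Finset.range (n + 1), jacobiCoeff n α β j * y ^ j := by
  have : (1 / 2 : ℂ) * (1 - (1 - 2 * y)) = y := by ring
  rw [jacobiPolynomial, eval_C_mul, eval_finsetSum]
  simp only [eval_mul, eval_C, eval_pow, eval_sub, eval_one, eval_X, this, jacobiCoeff]

/-- The prefactor `(-2)^{-n}` cancels the `(-1/2)^n` that the substitution `(1 - X) / 2` puts into
the leading coefficient. -/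
theorem eval_monicJacobi {n : ℕ} {α β : ℂ} (h : jacobiCoeff n α β n ≠ 0) (y : ℂ) :
    (-2 : ℂ) ^ (-(n : ℤ)) * (monicJacobi n α β).eval (1 - 2 * y) =
      ∑ j ∈ Finset.range (n + 1), jacobiCoeff n α β j / jacobiCoeff n α β n * y ^ j := by
  have hf : (n.factorial : ℂ) ≠ 0 := by exact_mod_cast n.factorial_ne_zero
  have h2 : (-2 : ℂ) ^ n * (-1 / 2) ^ n = 1 := by rw [← mul_pow]; norm_num
  rw [monicJacobi, eval_C_mul, eval_jacobiPolynomial, leadingCoeff_jacobiPolynomial h, zpow_neg,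
    zpow_natCast, ← mul_assoc, ← mul_assoc,
    Finset.mul_sum]
  refine Finset.sum_congr rfl fun j _ => ?_
  have e : (-2 : ℂ) ^ n * ((n.factorial : ℂ)⁻¹ * (jacobiCoeff n α β n * (-1 / 2) ^ n)) =
      (n.factorial : ℂ)⁻¹ * jacobiCoeff n α β n := by
    linear_combination (n.factorial : ℂ)⁻¹ * jacobiCoeff n α β n * h2
  rw [← mul_inv, e]
  field_simp

/-- After reversing both Pochhammer products, their `i`-th factors are the denominator and numerator
of the `i`-th factor of the ratio, each divided by `k`. -/
theorem aomotoRatio_mul_pochhammerSymbol {n k : ℕ} (hk : 1 ≤ k) {a b : ℂ} (ha : 0 < a.re)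
    (hb : 0 < b.re) {j m : ℕ} (hn : j + m = n) :
    aomotoRatio n a b k m *
      pochhammerSymbol (n + (a / k - 1) + (b / k - 1) + 1 + j) m =
      pochhammerSymbol (a / k - 1 + j + 1) m := by
  have hk0 : (k : ℂ) ≠ 0 := by exact_mod_cast (by omega : k ≠ 0)
  rw [aomotoRatio, pochhammerSymbol_eq_prod, pochhammerSymbol_eq_prod,
    ← Finset.prod_range_reflect (fun i : ℕ => (n + (a / k - 1) + (b / k - 1) + 1 + j + i : ℂ)),
    ← Finset.prod_range_reflect (fun i : ℕ => (a / k - 1 + j + 1 + i : ℂ)),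
    ← Finset.prod_mul_distrib]
  refine Finset.prod_congr rfl fun i hi => ?_
  have him : i + 1 ≤ m := Finset.mem_range.1 hi
  have hne : a + b + k * (2 * n - 2 - i) ≠ 0 := by
    have := ne_zero_of_pos_re_add_natCast (z := a + b) (by simpa using add_pos ha hb)
      (k * (2 * n - 2 - i))
    rwa [Nat.cast_mul, Nat.cast_sub (by omega), Nat.cast_sub (by omega), Nat.cast_mul,
      Nat.cast_two] at this
  rw [show m - 1 - i = m - (i + 1) by omega, Nat.cast_sub him]
  subst hn
  push_cast at hne ⊢
  rw [div_mul_eq_mul_div, div_eq_iff hne]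
  field_simp
  ring

theorem pochhammerSymbol_jacobi_ne_zero {n k : ℕ} (hk : 1 ≤ k) {a b : ℂ} (ha : 0 < a.re)
    (hb : 0 < b.re) :
    pochhammerSymbol (n + (a / k - 1) + (b / k - 1) + 1) n ≠ 0 := by
  have hk0 : (k : ℂ) ≠ 0 := by exact_mod_cast (by omega : k ≠ 0)
  rw [pochhammerSymbol_eq_prod, Finset.prod_ne_zero_iff]
  intro i hi
  have hin : i < n := Finset.mem_range.1 hi
  have := ne_zero_of_pos_re_add_natCast (z := a + b) (by simpa using add_pos ha hb)
      (k * (n - 1 + i))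
  rw [Nat.cast_mul, Nat.cast_add, Nat.cast_sub (by omega), Nat.cast_one] at this
  intro h
  apply this
  have e : a + b + k * (n - 1 + i) = k * (n + (a / k - 1) + (b / k - 1) + 1 + i) := by
    field_simp
    ring
  rw [e, h, mul_zero]

theorem jacobiCoeff_self_ne_zero {n k : ℕ} (hk : 1 ≤ k) {a b : ℂ} (ha : 0 < a.re)
    (hb : 0 < b.re) : jacobiCoeff n (a / k - 1) (b / k - 1) n ≠ 0 := by
  have hf : (n.factorial : ℂ) ≠ 0 := by exact_mod_cast n.factorial_ne_zero
  have := pochhammerSymbol_jacobi_ne_zero (n := n) hk ha hb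
  rw [jacobiCoeff, pochhammerSymbol_neg_natCast_self, Nat.sub_self]
  have h0 : pochhammerSymbol (a / k - 1 + n + 1) 0 = 1 := by simp [pochhammerSymbol]
  rw [h0, mul_one]
  exact div_ne_zero (mul_ne_zero (mul_ne_zero (pow_ne_zero _ (by norm_num)) hf) this) hf

theorem jacobiCoeff_div_self {n k : ℕ} (hk : 1 ≤ k) {a b : ℂ} (ha : 0 < a.re)
    (hb : 0 < b.re) {j m : ℕ} (hn : j + m = n) :
    jacobiCoeff n (a / k - 1) (b / k - 1) j / jacobiCoeff n (a / k - 1) (b / k - 1) n =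
      n.choose m * (-1) ^ m * aomotoRatio n a b k m := by
  have hr := aomotoRatio_mul_pochhammerSymbol hk ha hb hn
  rw [div_eq_iff (jacobiCoeff_self_ne_zero hk ha hb), jacobiCoeff, jacobiCoeff]
  have hj : (j.factorial : ℂ) ≠ 0 := by exact_mod_cast j.factorial_ne_zero
  have hnf : (n.factorial : ℂ) ≠ 0 := by exact_mod_cast n.factorial_ne_zero
  have hc : (n.choose m : ℂ) * m.factorial * j.factorial = n.factorial := by
    have := Nat.choose_mul_factorial_mul_factorial (show m ≤ n by omega)
    rw [show n - m = j by omega] at this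
    exact_mod_cast this
  -- Splitting off the first `j` factors leaves `(-m)_m`, the source of the sign and of `m!` in the
  -- binomial.
  have h1 : pochhammerSymbol (-(n : ℂ)) n =
      pochhammerSymbol (-(n : ℂ)) j * ((-1) ^ m * m.factorial) := by
    rw [← pochhammerSymbol_neg_natCast_self]
    conv_lhs => arg 2; rw [← hn]
    rw [pochhammerSymbol_add]
    congr 2
    rw [← hn]; push_cast; ring
  have h2 := pochhammerSymbol_add (n + (a / k - 1) + (b / k - 1) + 1) j m
  rw [hn] at h2
  have h3 : pochhammerSymbol (a / k - 1 + n + 1) (n - n) = 1 := by simp [pochhammerSymbol]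
  rw [h1, h2, h3, show n - j = m by omega, ← hr, ← hc]
  have hcm : (n.choose m : ℂ) ≠ 0 := by
    exact_mod_cast (Nat.choose_pos (show m ≤ n by omega)).ne'
  have hm : (m.factorial : ℂ) ≠ 0 := by exact_mod_cast m.factorial_ne_zero
  field_simp
  rw [← pow_mul, mul_comm m 2, pow_mul]
  simp

theorem mainTheorem2 (n k : ℕ) (hk : 1 ≤ k) (a b y : ℂ) (ha : 0 < a.re) (hb : 0 < b.re) :
    IntegrableOn (selbergIntegrand n a b k) (Set.Icc (0 : Fin n → ℝ) 1) volume ∧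
    IntegrableOn (aomotoIntegrand n a b k y) (Set.Icc (0 : Fin n → ℝ) 1) volume ∧
    aomotoIntegral n a b k y =
      (-2 : ℂ) ^ (-(n : ℤ)) * selbergIntegral n a b k *
        (monicJacobi n (a / k - 1) (b / k - 1)).eval (1 - 2 * y) := by
  have hd := continuous_deltaPow n k
  refine ⟨?_, ?_, ?_⟩
  · rw [funext (selbergIntegrand_eq n a b k)]
    exact integrableOn_mul_prod_betaWeight ha hb hd
  · rw [funext (aomotoIntegrand_eq n a b k y)]
    exact integrableOn_mul_prod_betaWeight ha hb (by fun_prop)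
  -- Moments are indexed by the subset size `m`, attached to `y^(n-m)`, and Jacobi terms by the
  -- power of `y`; hence the flip.
  · rw [aomotoIntegral_eq_sum ha hb hk, mul_right_comm,
      eval_monicJacobi (jacobiCoeff_self_ne_zero hk ha hb), mul_comm, ← Finset.sum_flip]
    congr 1
    refine Finset.sum_congr rfl fun m hm => ?_
    have hmn : m ≤ n := Nat.lt_succ_iff.1 (Finset.mem_range.1 hm)
    rw [jacobiCoeff_div_self (j := m) (m := n - m) hk ha hb (by omega),
      show n - (n - m) = m by omega]
    ring
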